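/- There is an absolute constant $c$ such that the following holds. Let $b\ge 1$ be an integer, let $V$ be a finite set of $n$ vertices, let $k$ be a natural number, and let a machine word consist of $w=b\lceil\log_2 n\rceil$ bits. Consider directed graphs $G$ on $V$ with non-negative integer edge capacities, each of which fits in one machine word (that is, is less than $2^w$), together with $k$ distinct terminals $q_1,\dots,q_k\in V$. Then there is an exact cut-preserving sketch for these graphs that uses space $O(kC^2)$. Precisely, there are a compression map, which assigns to each such $G$ with its terminals a finite sequence of machine words (the sketch), and an extraction map, which sees only the sketch and the query and no other information about $G$ and its terminals, such that for every $G$ and all terminals $T=\{q_1,\dots,q_k\}$: 1. for any two disjoint sets $A,B\subseteq T$ (specified by the indices of their elements; in particular for every bipartition $B=T\setminus A$), the extraction map applied to the sketch and the query $(A,B)$ returns the exact value of the minimum cut from $A$ to $B$ in $G$, i.e. the minimum, over all $S\subseteq V$ with $A\subseteq S$ and $S\cap B=\emptyset$, of the total capacity of the edges that leave $S$; 2. the sketch consists of at most $c\,k\,C^2$ machine words, where $C$ is the total capacity of the edges of $G$ incident on the terminals. -/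

import Mathlib

/-- A directed graph on the vertex set `V` with integer edge capacities: `cap u v` is the capacity
of the edge from `u` to `v`, and `cap u v = 0` means that there is no such edge. -/
structure CapDigraph (V : Type*) where
  cap : V → V → ℕ

namespace CapDigraph

variable {V : Type*} [Fintype V] [DecidableEq V]

/-- The total capacity of the edges that leave the vertex set `S`. -/
def cutCapacity (G : CapDigraph V) (S : Finset V) : ℕ :=
  ∑ e : V × V with e.1 ∈ S ∧ e.2 ∉ S, G.cap e.1 e.2

/-- The values of all cuts that separate `A` from `B`: a cut is a vertex set `S` that contains `A`
and is disjoint from `B`, and its value is the capacity of the edges leaving `S`. -/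
def cutValues (G : CapDigraph V) (A B : Finset V) : Set ℕ :=
  {c | ∃ S : Finset V, A ⊆ S ∧ Disjoint S B ∧ G.cutCapacity S = c}

/-- `c` is the value of the minimum cut from `A` to `B`. -/
def IsMinCutValue (G : CapDigraph V) (A B : Finset V) (c : ℕ) : Prop :=
  IsLeast (G.cutValues A B) c

/-- The total capacity of the edges incident on the vertices of `T`, every edge counted once. -/
def incidentCapacity (G : CapDigraph V) (T : Finset V) : ℕ :=
  ∑ e : V × V with e.1 ∈ T ∨ e.2 ∈ T, G.cap e.1 e.2

end CapDigraph

/-- The number of bits of a machine word for graphs on `n` vertices, `b * ⌈log₂ n⌉`. -/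
def wordLength (b n : ℕ) : ℕ := b * Nat.clog 2 n

/-- A sketching scheme for the terminal cuts of capacitated digraphs on `V` with `k` terminals,
which stores words of `w` bits. The compression sees the graph and its (distinct) terminals
`q 0, …, q (k - 1)`. The extraction sees only the stored words and the query, which is a pair of
sets of terminals, given by their indices. -/
structure CutSketch (w : ℕ) (V : Type*) (k : ℕ) where
  compress : CapDigraph V → (Fin k ↪ V) → List (BitVec w)
  extract : List (BitVec w) → Finset (Fin k) → Finset (Fin k) → ℕ

namespace CutSketch

variable {w : ℕ} {V : Type*} {k : ℕ}

/-- The scheme is exact on `G` with terminals `q`: for any two disjoint sets of terminals (in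
particular for the two sides of any bipartition of the terminals) the extraction returns the value
of the minimum cut in `G` from the first to the second. -/
def IsExactOn [Fintype V] [DecidableEq V] (Γ : CutSketch w V k) (G : CapDigraph V)
    (q : Fin k ↪ V) : Prop :=
  ∀ A B : Finset (Fin k), Disjoint A B →
    G.IsMinCutValue (A.map q) (B.map q) (Γ.extract (Γ.compress G q) A B)

/-- The number of machine words that are stored for `G` with terminals `q`. -/
def size (Γ : CutSketch w V k) (G : CapDigraph V) (q : Fin k ↪ V) : ℕ :=
  (Γ.compress G q).length

end CutSketch

/-! Replace an edge of capacity `c` by `c` parallel edges. Let `Q` be an edge-by-edge matrix over a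
finite field, supported on the diagonal and on the pairs in which the second edge continues the
first. For suitable entries, `Q` is invertible and the block of `Q⁻¹` with rows leaving `A` and
columns entering `B` has rank equal to the minimum cut.

The nullity theorem (`rank_submatrix_add_card_of_mul_eq_one`) turns this into a claim about the
block of `Q` on edges not entering `B` and edges not leaving `A`. A cut forces a zero block there,
which bounds the rank above (`rank_submatrix_add_card_le_cutCard`). Below, Hall's theorem gives a
large matching in the pattern (`exists_matching_of_le_cutCard`), hence a generically nonzero minor.
By Schwartz–Zippel one choice of entries serves all queries at once, over a field of `2 ^ O(k * w)`
elements.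

Queries only read rows and columns of edges incident on terminals, so a `C × C` matrix with entries
of `O(k)` words suffices. -/

open Module Finset

/-! ### Linear algebra: the nullity theorem and rank bounds. -/

namespace Matrix

variable {F E : Type*} [Field F] [Fintype E]

/-- The vectors supported on `c` whose image under `M` vanishes on `r`. -/
def restrictedKer (M : Matrix E E F) (r c : E → Prop) : Submodule F (E → F) where
  carrier := {v | (∀ e, ¬ c e → v e = 0) ∧ ∀ e, r e → (M *ᵥ v) e = 0}
  zero_mem' := by simp
  add_mem' := by
    rintro v w ⟨hv, hv'⟩ ⟨hw, hw'⟩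
    refine ⟨fun e he => by simp [hv e he, hw e he], fun e he => ?_⟩
    simp [mulVec_add, hv' e he, hw' e he]
  smul_mem' := by
    rintro a v ⟨hv, hv'⟩
    refine ⟨fun e he => by simp [hv e he], fun e he => ?_⟩
    simp [mulVec_smul, hv' e he]

theorem submatrix_val_mulVec (M : Matrix E E F) (r c : E → Prop) [DecidablePred c]
    {v : E → F} (hv : ∀ e, ¬ c e → v e = 0) (e : {e // r e}) :
    (M.submatrix (Subtype.val : {e // r e} → E) (Subtype.val : {e // c e} → E) *ᵥ
      fun f => v f) e = (M *ᵥ v) e := by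
  simp only [mulVec, dotProduct, submatrix_apply]
  rw [← Finset.sum_filter_of_ne (p := c) fun f _ hf => by
    by_contra h
    simp [hv f h] at hf]
  exact (Finset.sum_subtype (univ.filter c) (by simp) fun f => M e f * v f).symm

/-- The kernel of a submatrix consists of the vectors of `restrictedKer`, restricted. -/
def restrictedKerEquiv (M : Matrix E E F) (r c : E → Prop) [DecidablePred c] :
    M.restrictedKer r c ≃ₗ[F] LinearMap.ker
      (M.submatrix (Subtype.val : {e // r e} → E) (Subtype.val : {e // c e} → E)).mulVecLin where
  toFun v := ⟨fun f => v.1 f, by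
    rw [LinearMap.mem_ker]
    ext e
    exact (M.submatrix_val_mulVec r c v.2.1 e).trans (v.2.2 e e.2)⟩
  map_add' _ _ := rfl
  map_smul' _ _ := rfl
  invFun u := ⟨fun e => if h : c e then u.1 ⟨e, h⟩ else 0, fun e he => by simp [he], fun e he => by
    rw [← M.submatrix_val_mulVec r c (fun e he => by simp [he]) ⟨e, he⟩]
    have hu : (fun f : {e // c e} => if h : c f then u.1 ⟨f, h⟩ else 0) = u.1 := by
      ext f
      simp [f.2]
    rw [hu]
    exact congrFun (LinearMap.mem_ker.1 u.2) ⟨e, he⟩⟩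
  left_inv v := by
    ext e
    by_cases h : c e
    · simp [h]
    · simp [h, v.2.1 e h]
  right_inv u := by
    ext e
    simp [e.2]

/-- Multiplication by an inverse matrix exchanges the restricted kernels of complementary
submatrices. -/
def restrictedKerInvEquiv [DecidableEq E] {N Q : Matrix E E F} (hQN : Q * N = 1) (p q : E → Prop) :
    N.restrictedKer p q ≃ₗ[F] Q.restrictedKer (fun e => ¬ q e) (fun e => ¬ p e) where
  toFun v := ⟨N *ᵥ v.1, fun e he => v.2.2 e (not_not.1 he), fun e he => by
    rw [mulVec_mulVec, hQN, one_mulVec]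
    exact v.2.1 e he⟩
  map_add' v w := by ext1; simp [mulVec_add]
  map_smul' a v := by ext1; simp [mulVec_smul]
  invFun u := ⟨Q *ᵥ u.1, u.2.2, fun e he => by
    rw [mulVec_mulVec, mul_eq_one_comm.1 hQN, one_mulVec]
    exact u.2.1 e (not_not.2 he)⟩
  left_inv v := by ext1; simp [mulVec_mulVec, hQN]
  right_inv u := by ext1; simp [mulVec_mulVec, mul_eq_one_comm.1 hQN]

theorem rank_add_finrank_ker {m n : Type*} [Fintype n] (M : Matrix m n F) :
    M.rank + finrank F (LinearMap.ker M.mulVecLin) = Fintype.card n := by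
  rw [rank, LinearMap.finrank_range_add_finrank_ker, finrank_pi]

/-- The nullity theorem: the ranks of complementary submatrices of inverse matrices differ by a
quantity that depends on their sizes only. -/
theorem rank_submatrix_add_card_of_mul_eq_one [DecidableEq E] {N Q : Matrix E E F}
    (hQN : Q * N = 1) (p q : E → Prop) [DecidablePred p] [DecidablePred q] :
    (N.submatrix (Subtype.val : {e // p e} → E) (Subtype.val : {e // q e} → E)).rank
        + Fintype.card E =
      (Q.submatrix (Subtype.val : {e // ¬ q e} → E) (Subtype.val : {e // ¬ p e} → E)).rank
        + Fintype.card {e // p e} + Fintype.card {e // q e} := by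
  have h₁ := (N.submatrix (Subtype.val : {e // p e} → E)
    (Subtype.val : {e // q e} → E)).rank_add_finrank_ker
  have h₂ := (Q.submatrix (Subtype.val : {e // ¬ q e} → E)
    (Subtype.val : {e // ¬ p e} → E)).rank_add_finrank_ker
  -- The two blocks have isomorphic kernels, so rank–nullity on each side finishes the count.
  have h₃ := (((N.restrictedKerEquiv p q).symm.trans (restrictedKerInvEquiv hQN p q)).trans
    (Q.restrictedKerEquiv _ _)).finrank_eq
  have h₄ := Fintype.card_subtype_compl p
  have h₅ := Fintype.card_subtype_le p
  omega

theorem rank_add_le' {m n : Type*} [Fintype m] [Fintype n] (M N : Matrix m n F) :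
    (M + N).rank ≤ M.rank + N.rank := by
  rw [rank, mulVecLin_add]
  exact (Submodule.finrank_mono (LinearMap.range_add_le _ _)).trans
    (Submodule.finrank_add_le_finrank_add_finrank _ _)

/-- A matrix whose entries vanish outside the rows in `s` and the columns in `t` has rank at most
`#s + #t`. -/
theorem rank_le_card_add_card {m n : Type*} [Fintype m] [Fintype n] (M : Matrix m n F)
    (s : Finset m) (t : Finset n) (h : ∀ i ∉ s, ∀ j ∉ t, M i j = 0) : M.rank ≤ #s + #t := by
  classical
  let M₁ : Matrix m n F := of fun i j => if i ∈ s then M i j else 0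
  let M₂ : Matrix m n F := of fun i j => if i ∈ s then 0 else M i j
  have hM : M = M₁ + M₂ := by
    ext i j
    by_cases hi : i ∈ s <;> simp [M₁, M₂, hi]
  have h₁ : M₁.rank ≤ #s := rank_le_card_of_support_subset _ _ <| by
    rw [Function.support_subset_iff']
    intro i hi
    ext j
    have : i ∉ s := hi
    simp [M₁, row, this]
  have h₂ : M₂.rank ≤ #t := by
    rw [← rank_transpose]
    refine rank_le_card_of_support_subset _ _ ?_
    rw [Function.support_subset_iff']
    intro j hj
    ext i
    have : j ∉ t := hj
    by_cases hi : i ∈ s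
    · simp [M₂, row, hi]
    · simp [M₂, row, hi, h i hi j this]
  calc M.rank = (M₁ + M₂).rank := by rw [← hM]
    _ ≤ M₁.rank + M₂.rank := rank_add_le' _ _
    _ ≤ _ := by omega

/-! ### Generic matrices with a prescribed pattern. -/

/-- The matrix with entries `x (e, f)` for related `e` and `f` and zeros elsewhere. -/
def ofRel {R E : Type*} [Zero R] (r : E → E → Prop) [DecidableRel r] (x : E × E → R) :
    Matrix E E R :=
  of fun e f => if r e f then x (e, f) else 0

theorem totalDegree_det_le {σ R ι : Type*} [CommRing R] [Fintype ι] [DecidableEq ι]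
    (M : Matrix ι ι (MvPolynomial σ R)) (h : ∀ i j, (M i j).totalDegree ≤ 1) :
    M.det.totalDegree ≤ Fintype.card ι := by
  rw [det_apply]
  refine MvPolynomial.totalDegree_finsetSum_le fun σ _ => ?_
  refine (MvPolynomial.totalDegree_smul_le _ _).trans ?_
  refine (MvPolynomial.totalDegree_finsetProd _ _).trans ?_
  refine (Finset.sum_le_card_nsmul _ _ 1 fun i _ => h _ _).trans ?_
  simp

omit [Fintype E] in
/-- The square submatrix of a generic matrix along a matching is generically nonsingular. -/
theorem det_ofRel_X_submatrix_ne_zero {r : E → E → Prop} [DecidableRel r] {ι : Type*} [Fintype ι]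
    [DecidableEq ι] {a b : ι → E} (ha : a.Injective) (hb : b.Injective) (hr : ∀ i, r (a i) (b i)) :
    ((ofRel r (MvPolynomial.X : E × E → MvPolynomial (E × E) F)).submatrix a b).det ≠ 0 := by
  classical
  intro h
  -- At the indicator of the matching, the submatrix becomes the identity.
  let x : E × E → F := fun e => if ∃ i, a i = e.1 ∧ b i = e.2 then 1 else 0
  have h' := congrArg (MvPolynomial.eval x) h
  rw [RingHom.map_det, map_zero] at h'
  have : (MvPolynomial.eval x).mapMatrix
      ((ofRel r (MvPolynomial.X : E × E → MvPolynomial (E × E) F)).submatrix a b) = 1 := by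
    ext i j
    simp only [RingHom.mapMatrix_apply, map_apply, submatrix_apply, ofRel, of_apply, one_apply]
    have hx : x (a i, b j) = if i = j then 1 else 0 := by
      simp only [x]
      congr 1
      refine propext ⟨?_, fun h => ⟨i, rfl, h ▸ rfl⟩⟩
      rintro ⟨l, h₁, h₂⟩
      rw [← ha h₁, hb h₂]
    by_cases hij : i = j
    · subst hij
      simp [hr, hx]
    · split_ifs <;> simp [hx, hij]
  rw [this, det_one] at h'
  exact one_ne_zero h'

/-- Over a large field, finitely many matchings are made nonsingular by a single choice of the
entries. -/
theorem exists_ofRel_det_submatrix_ne_zero [Finite F] {r : E → E → Prop} [DecidableRel r]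
    {J : Type*} [Fintype J] {m : J → ℕ} {a b : ∀ j, Fin (m j) → E}
    (ha : ∀ j, (a j).Injective) (hb : ∀ j, (b j).Injective) (hr : ∀ j i, r (a j i) (b j i))
    (hF : Fintype.card J * Fintype.card E < Nat.card F) :
    ∃ x : E × E → F, ∀ j, ((ofRel r x).submatrix (a j) (b j)).det ≠ 0 := by
  classical
  have := Fintype.ofFinite F
  let G : Matrix E E (MvPolynomial (E × E) F) := ofRel r MvPolynomial.X
  -- A nonroot of the product is a nonroot of every factor.
  let P : MvPolynomial (E × E) F := ∏ j, (G.submatrix (a j) (b j)).det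
  have hP : P ≠ 0 :=
    Finset.prod_ne_zero_iff.2 fun j _ => det_ofRel_X_submatrix_ne_zero (ha j) (hb j) (hr j)
  have hdeg : P.totalDegree ≤ Fintype.card J * Fintype.card E := by
    refine (MvPolynomial.totalDegree_finsetProd _ _).trans ?_
    refine (Finset.sum_le_card_nsmul _ _ (Fintype.card E) fun j _ => ?_).trans (by simp)
    refine (totalDegree_det_le _ fun i i' => ?_).trans (Fintype.card_le_of_injective _ (ha j))
    simp only [G, ofRel, submatrix_apply, of_apply]
    split_ifs <;> simp
  have : ∃ x, MvPolynomial.eval x P ≠ 0 := by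
    by_contra! h
    refine hP (MvPolynomial.eq_zero_of_eval_zero_at_prod_finset P (fun _ => univ) (fun i => ?_)
      fun x _ => h x)
    rw [card_univ, ← Nat.card_eq_fintype_card]
    exact ((MvPolynomial.degreeOf_le_totalDegree _ _).trans hdeg).trans_lt hF
  obtain ⟨x, hx⟩ := this
  refine ⟨x, fun j => ?_⟩
  rw [map_prod] at hx
  have := Finset.prod_ne_zero_iff.1 hx j (mem_univ j)
  rw [RingHom.map_det] at this
  convert this using 2
  ext i i'
  simp only [G, ofRel, submatrix_apply, of_apply, RingHom.mapMatrix_apply, map_apply]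
  split_ifs <;> simp

end Matrix

/-! ### Hall's theorem with deficiency. -/

/-- Hall's theorem with deficiency `d`, with the unmatched elements sent to dummies. -/
theorem exists_injective_sum_fin_of_card_le {ι α : Type*} [DecidableEq α] (t : ι → Finset α)
    (d : ℕ) (h : ∀ s : Finset ι, #s ≤ #(s.biUnion t) + d) :
    ∃ f : ι → α ⊕ Fin d, f.Injective ∧ ∀ i a, f i = Sum.inl a → a ∈ t i := by
  obtain ⟨f, hf, hft⟩ := (Finset.all_card_le_biUnion_card_iff_exists_injective
    (fun i => (t i).disjSum (univ : Finset (Fin d)))).1 fun s => by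
      rcases s.eq_empty_or_nonempty with rfl | ⟨i, hi⟩
      · simp
      have : s.biUnion (fun i => (t i).disjSum (univ : Finset (Fin d))) =
          (s.biUnion t).disjSum univ := by
        ext (a | a)
        · simp
        · simpa using ⟨i, hi⟩
      rw [this, card_disjSum, card_univ, Fintype.card_fin]
      exact h s
  exact ⟨f, hf, fun i a ha => by simpa [ha] using hft i⟩

/-- Hall's theorem with deficiency: a matching that misses at most `d` elements. -/
theorem exists_matching_of_card_le {ι α : Type*} [Fintype ι] [DecidableEq α] (t : ι → Finset α)
    (d : ℕ) (h : ∀ s : Finset ι, #s ≤ #(s.biUnion t) + d) :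
    ∃ (a : Fin (Fintype.card ι - d) → ι) (b : Fin (Fintype.card ι - d) → α),
      a.Injective ∧ b.Injective ∧ ∀ i, b i ∈ t (a i) := by
  classical
  obtain ⟨f, hf, hft⟩ := exists_injective_sum_fin_of_card_le t d h
  let u : Finset ι := {i | (f i).isLeft}
  have hu : Fintype.card ι - d ≤ Fintype.card u := by
    have h₁ : #(univ.filter fun i => ¬ (f i).isLeft) ≤ #(univ : Finset (Fin d)) := by
      rw [← card_map (f := ⟨(Sum.inr : Fin d → α ⊕ Fin d), Sum.inr_injective⟩),
        ← card_image_of_injective _ hf]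
      refine card_le_card fun y hy => ?_
      obtain ⟨i, hi, rfl⟩ := mem_image.1 hy
      rcases hfi : f i with a | a
      · simp [hfi] at hi
      · simp
    have h₂ := card_filter_add_card_filter_not (s := (univ : Finset ι)) (fun i => (f i).isLeft)
    simp only [card_univ, Fintype.card_fin] at h₁ h₂
    rw [Fintype.card_coe]
    change _ ≤ #(univ.filter fun i => (f i).isLeft)
    omega
  let g : Fin (Fintype.card ι - d) → u := fun i => (Fintype.equivFin u).symm (Fin.castLE hu i)
  have hg : g.Injective := (Equiv.injective _).comp (Fin.castLE_injective hu)
  have hl : ∀ i, (f (g i)).isLeft := fun i => (mem_filter.1 (g i).2).2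
  have hfl : ∀ i, f (g i) = Sum.inl ((f (g i)).getLeft (hl i)) := fun i => by simp
  refine ⟨fun i => g i, fun i => (f (g i)).getLeft (hl i), Subtype.val_injective.comp hg, ?_,
    fun i => hft _ _ (hfl i)⟩
  intro i j hij
  refine hg (Subtype.ext (hf ?_))
  rw [hfl i, hfl j]
  exact congrArg _ hij

/-! ### Minimum cuts as ranks of blocks of an inverse edge matrix. -/

namespace EdgeCut

variable {V E : Type*} [Fintype E] [DecidableEq V] [DecidableEq E]
  (tail head : E → V)

/-- The pattern of the edge matrix: `e` is related to itself and to the edges that continue it. -/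
def Continues (e f : E) : Prop := e = f ∨ head e = tail f

instance : DecidableRel (Continues tail head) :=
  fun _ _ => inferInstanceAs (Decidable (_ ∨ _))

/-- The number of edges leaving the vertex set `S`. -/
def cutCard (S : Finset V) : ℕ := #{e : E | tail e ∈ S ∧ head e ∉ S}

variable {tail head}

/-- If every cut from `A` to `B` has at least `m` edges, then the pattern of the edge matrix has a
matching between the edges not entering `B` and the edges not leaving `A` which, in view of the
nullity theorem, witnesses rank `m` of the complementary part of the inverse. -/
theorem exists_matching_of_le_cutCard {A B : Finset V} {m : ℕ}
    (hAB : Disjoint A B)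
    (hm : ∀ S : Finset V, A ⊆ S → Disjoint S B → m ≤ cutCard tail head S) :
    ∃ (l : ℕ) (a b : Fin l → E), a.Injective ∧ b.Injective ∧
      (∀ i, Continues tail head (a i) (b i)) ∧ (∀ i, head (a i) ∉ B) ∧ (∀ i, tail (b i) ∉ A) ∧
      m + Fintype.card E ≤
        l + Fintype.card {e // tail e ∈ A} + Fintype.card {e // head e ∈ B} := by
  -- Makes the truncated subtraction in the deficiency below exact.
  have hmA : m ≤ Fintype.card {e // tail e ∈ A} := by
    refine (hm A subset_rfl hAB).trans ?_
    rw [Fintype.card_subtype]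
    exact card_le_card fun e he => by simp at he ⊢; exact he.1
  let t : {e // head e ∉ B} → Finset E :=
    fun e => univ.filter fun f => Continues tail head e f ∧ tail f ∉ A
  obtain ⟨a, b, ha, hb, hab⟩ := exists_matching_of_card_le t
    (Fintype.card {e // tail e ∈ A} - m) fun U => by
      let U' : Finset E := U.map (Function.Embedding.subtype _)
      -- The edges of `U`, those of `Y` and those leaving `S` are pairwise disjoint. Since at least
      -- `m` edges leave `S`, `U` and `Y` cannot both be large, which is Hall's condition.
      let Y : Finset E := univ.filter fun f => tail f ∉ A ∧ f ∉ U.biUnion t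
      let S : Finset V := A ∪ U'.image head
      have hU' : ∀ e ∈ U', head e ∉ B := by
        intro e he
        obtain ⟨e', _, rfl⟩ := mem_map.1 he
        exact e'.2
      have hS := hm S subset_union_left (by
        rw [disjoint_union_left]
        refine ⟨hAB, disjoint_left.2 fun v hv => ?_⟩
        obtain ⟨e, he, rfl⟩ := mem_image.1 hv
        exact hU' e he)
      have hUt : ∀ e ∈ U', ∀ f ∈ Y, ¬ Continues tail head e f := by
        intro e he f hf hef
        obtain ⟨e', he', rfl⟩ := mem_map.1 he
        obtain ⟨hf₁, hf₂⟩ := (mem_filter.1 hf).2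
        exact hf₂ (mem_biUnion.2 ⟨e', he', by simpa [t] using ⟨hef, hf₁⟩⟩)
      have hUY : Disjoint U' Y := disjoint_left.2 fun e he he' => hUt e he e he' (Or.inl rfl)
      have hcut : Disjoint (univ.filter fun e => tail e ∈ S ∧ head e ∉ S) (U' ∪ Y) := by
        refine disjoint_left.2 fun e he heUY => ?_
        obtain ⟨h₁, h₂⟩ := (mem_filter.1 he).2
        rcases mem_union.1 heUY with h | h
        · exact h₂ (mem_union_right _ (mem_image_of_mem _ h))
        · rcases mem_union.1 h₁ with h' | h'
          · exact (mem_filter.1 h).2.1 h'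
          · obtain ⟨f, hf, hfe⟩ := mem_image.1 h'
            exact hUt f hf e h (Or.inr hfe)
      have hcard : cutCard tail head S + (#U + #Y) ≤ Fintype.card E := by
        rw [← card_map (s := U) (Function.Embedding.subtype _), ← card_union_of_disjoint hUY,
          cutCard, ← card_union_of_disjoint hcut]
        exact card_le_univ _
      have hY : Fintype.card E ≤ Fintype.card {e // tail e ∈ A} + #(U.biUnion t) + #Y := by
        rw [Fintype.card_subtype, ← card_univ]
        refine (card_le_card (t := (univ.filter fun e => tail e ∈ A) ∪ U.biUnion t ∪ Y) ?_).trans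
          ((card_union_le _ _).trans (Nat.add_le_add_right (card_union_le _ _) _))
        intro e _
        by_cases h₁ : tail e ∈ A
        · simp [h₁]
        · by_cases h₂ : e ∈ U.biUnion t
          · exact mem_union_left _ (mem_union_right _ h₂)
          · exact mem_union_right _ (by simpa [Y, h₁] using h₂)
      omega
  refine ⟨_, fun i => a i, b, Subtype.val_injective.comp ha, hb,
    fun i => (mem_filter.1 (hab i)).2.1, fun i => (a i).2, fun i => (mem_filter.1 (hab i)).2.2, ?_⟩
  have := Fintype.card_subtype_compl fun e => head e ∈ B
  have := Fintype.card_subtype_le fun e => head e ∈ B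
  omega

variable {F : Type*} [Field F]

/-- Each cut bounds the rank of the part of the edge matrix that is complementary, in the sense of
the nullity theorem, to the edges leaving `A` and the edges entering `B`. -/
theorem rank_submatrix_add_card_le_cutCard {A B S : Finset V} (hA : A ⊆ S) (hB : Disjoint S B)
    (x : E × E → F) :
    ((Matrix.ofRel (Continues tail head) x).submatrix (Subtype.val : {e // head e ∉ B} → E)
      (Subtype.val : {e // tail e ∉ A} → E)).rank + Fintype.card {e // tail e ∈ A} +
      Fintype.card {e // head e ∈ B} ≤ cutCard tail head S + Fintype.card E := by
  let s : Finset {e // head e ∉ B} := univ.filter fun e => head e ∉ S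
  let t : Finset {e // tail e ∉ A} := univ.filter fun e => tail e ∈ S ∨ head e ∈ S
  have hrank := Matrix.rank_le_card_add_card
    -- An edge with head in `S` is neither equal to nor continued by an edge with both ends outside
    -- `S`: this is the zero block.
    ((Matrix.ofRel (Continues tail head) x).submatrix (Subtype.val : {e // head e ∉ B} → E)
      (Subtype.val : {e // tail e ∉ A} → E)) s t fun e he f hf => by
    have he' : head e ∈ S := by simpa [s] using he
    have hf' : tail f ∉ S ∧ head f ∉ S := by simpa [t] using hf
    have : ¬ Continues tail head e f := by
      rintro (h | h)
      · exact hf'.2 (h ▸ he')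
      · exact hf'.1 (h ▸ he')
    simp [Matrix.ofRel, this]
  have hs : #s + Fintype.card {e // head e ∈ B} ≤ #{e : E | head e ∉ S} := by
    rw [Fintype.card_subtype, ← card_map (s := s) (Function.Embedding.subtype _),
      ← card_union_of_disjoint]
    · refine card_le_card fun e he => ?_
      rcases mem_union.1 he with h | h
      · obtain ⟨e', he', rfl⟩ := mem_map.1 h
        simpa [s] using he'
      · simpa using disjoint_right.1 hB (by simpa using h)
    · refine disjoint_left.2 fun e he he' => ?_
      obtain ⟨e', _, rfl⟩ := mem_map.1 he
      exact e'.2 (by simpa using he')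
  have ht : #t + Fintype.card {e // tail e ∈ A} ≤ #{e : E | tail e ∈ S ∨ head e ∈ S} := by
    rw [Fintype.card_subtype, ← card_map (s := t) (Function.Embedding.subtype _),
      ← card_union_of_disjoint]
    · refine card_le_card fun e he => ?_
      rcases mem_union.1 he with h | h
      · obtain ⟨e', he', rfl⟩ := mem_map.1 h
        simpa [t] using he'
      · simpa using Or.inl (hA (by simpa using h))
    · refine disjoint_left.2 fun e he he' => ?_
      obtain ⟨e', _, rfl⟩ := mem_map.1 he
      exact e'.2 (by simpa using he')
  have hcut : #{e : E | head e ∉ S} + #{e : E | tail e ∈ S ∨ head e ∈ S} =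
      cutCard tail head S + Fintype.card E := by
    rw [← card_inter_add_card_union, cutCard, ← card_univ (α := E)]
    congr 2
    · ext e
      simp only [mem_inter, mem_filter, mem_univ, true_and]
      tauto
    · ext e
      simp only [mem_union, mem_filter, mem_univ, true_and, iff_true]
      tauto
  omega

/-- Over a large field, a single matrix indexed by the edges represents the minimum cuts between
finitely many pairs of disjoint vertex sets: the minimum cut from `A` to `B` is the rank of the
rows of the edges leaving `A` and the columns of the edges entering `B`. -/
theorem exists_matrix_rank_eq_minCut [Finite F] {J : Type*} [Fintype J] {A B : J → Finset V}
    {m : J → ℕ} (hAB : ∀ j, Disjoint (A j) (B j))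
    (hm : ∀ j, IsLeast {c | ∃ S, A j ⊆ S ∧ Disjoint S (B j) ∧ cutCard tail head S = c} (m j))
    (hF : (Fintype.card J + 1) * Fintype.card E < Nat.card F) :
    ∃ N : Matrix E E F, ∀ j, (N.submatrix (Subtype.val : {e // tail e ∈ A j} → E)
      (Subtype.val : {e // head e ∈ B j} → E)).rank = m j := by
  choose l a b ha hb hab haB hbA hl using fun j => exists_matching_of_le_cutCard (hAB j)
    fun S h₁ h₂ => (hm j).2 ⟨S, h₁, h₂, rfl⟩
  let e₀ := (Fintype.equivFin E).symm
  -- The extra index `none` carries the diagonal matching, whose minor is the determinant of the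
  -- whole matrix up to reindexing; this makes `Q` invertible.
  obtain ⟨x, hx⟩ := Matrix.exists_ofRel_det_submatrix_ne_zero (F := F)
    (r := Continues tail head) (J := Option J)
    (m := fun o => o.elim (Fintype.card E) l)
    (a := fun o => match o with | none => e₀ | some j => a j)
    (b := fun o => match o with | none => e₀ | some j => b j)
    (by rintro (_ | j); exacts [e₀.injective, ha j])
    (by rintro (_ | j); exacts [e₀.injective, hb j])
    (by rintro (_ | j); exacts [fun i => Or.inl rfl, hab j])
    (by simpa using hF)
  let Q : Matrix E E F := Matrix.ofRel (Continues tail head) x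
  have hQ : IsUnit Q.det := by
    have : (Q.submatrix e₀ e₀).det ≠ 0 := hx none
    rw [isUnit_iff_ne_zero]
    rwa [Matrix.det_submatrix_equiv_self] at this
  refine ⟨Q⁻¹, fun j => ?_⟩
  have hnull := Matrix.rank_submatrix_add_card_of_mul_eq_one (Q.mul_nonsing_inv hQ)
    (fun e => tail e ∈ A j) (fun e => head e ∈ B j)
  obtain ⟨S, hS₁, hS₂, hS⟩ := (hm j).1
  have hle := rank_submatrix_add_card_le_cutCard (tail := tail) (head := head) hS₁ hS₂ x
  change (Q.submatrix _ _).rank + _ + _ ≤ _ at hle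
  have hge : l j ≤ (Q.submatrix (Subtype.val : {e // head e ∉ B j} → E)
      (Subtype.val : {e // tail e ∉ A j} → E)).rank := by
    have h₁ := Matrix.rank_submatrix_le (Q.submatrix (Subtype.val : {e // head e ∉ B j} → E)
      (Subtype.val : {e // tail e ∉ A j} → E)) (fun i => ⟨a j i, haB j i⟩)
      (fun i => ⟨b j i, hbA j i⟩)
    have h₂ := Matrix.rank_of_det_ne_zero (hx (some j))
    rw [Fintype.card_fin] at h₂
    exact h₂.symm.le.trans h₁
  have := hl j
  omega

end EdgeCut

/-! ### From capacities to parallel edges. -/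

namespace CapDigraph

variable {V : Type*}

/-- The edges of `G`, an edge of capacity `c` being counted as `c` parallel edges. -/
abbrev Edge (G : CapDigraph V) : Type _ := Σ p : V × V, Fin (G.cap p.1 p.2)

variable [Fintype V] (G : CapDigraph V)

theorem card_filter_edge (P : V × V → Prop) [DecidablePred P] :
    #{e : G.Edge | P e.1} = ∑ p : V × V with P p, G.cap p.1 p.2 := by
  have : (univ.filter fun e : G.Edge => P e.1) =
      (univ.filter P).sigma fun p => (univ : Finset (Fin (G.cap p.1 p.2))) := by
    ext e
    simp
  rw [this, card_sigma]
  simp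

theorem card_edge_le {M : ℕ} (hM : ∀ u v, G.cap u v ≤ M) :
    Fintype.card G.Edge ≤ Fintype.card V ^ 2 * M := by
  rw [Fintype.card_sigma]
  refine (Finset.sum_le_card_nsmul _ _ M fun p _ => by simpa using hM p.1 p.2).trans ?_
  simp [sq]

variable [DecidableEq V]

theorem cutCard_edge (S : Finset V) :
    EdgeCut.cutCard (fun e : G.Edge => e.1.1) (fun e => e.1.2) S = G.cutCapacity S :=
  G.card_filter_edge fun p => p.1 ∈ S ∧ p.2 ∉ S

theorem exists_isMinCutValue {A B : Finset V} (h : Disjoint A B) : ∃ c, G.IsMinCutValue A B c :=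
  ⟨_, Nat.sInf_mem (s := G.cutValues A B) ⟨_, A, subset_rfl, h, rfl⟩, fun _ hc => Nat.sInf_le hc⟩

theorem isMinCutValue_zero {A B T : Finset V} (hAT : A ⊆ T) (hAB : Disjoint A B)
    (hT : G.incidentCapacity T = 0) : G.IsMinCutValue A B 0 := by
  refine ⟨⟨A, subset_rfl, hAB, Nat.eq_zero_of_le_zero (hT ▸ ?_)⟩, fun _ _ => Nat.zero_le _⟩
  refine Finset.sum_le_sum_of_subset fun p hp => ?_
  simp only [mem_filter, mem_univ, true_and] at hp ⊢
  exact Or.inl (hAT hp.1)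

end CapDigraph

/-! ### Cut matrices: existence and size. -/

/-- A linear representation of the cuts between `k` terminals with `C` incident edges: the terminal
(if any) that each edge leaves, the terminal (if any) that it enters, and a matrix over `F` indexed
by the incident edges. -/
abbrev CutMatrix (F : Type*) (k C : ℕ) : Type _ :=
  (Fin C → Option (Fin k)) × (Fin C → Option (Fin k)) × Matrix (Fin C) (Fin C) F

namespace CutMatrix

variable {F : Type*} {k C : ℕ}

/-- The cut value from `A` to `B` that is represented by `d`: the rank of the rows of the edges
leaving `A` and the columns of the edges entering `B`. -/
noncomputable def value [Field F] (d : CutMatrix F k C) (A B : Finset (Fin k)) : ℕ :=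
  (d.2.2.submatrix (Subtype.val : {i // d.1 i ∈ A.map Function.Embedding.some} → Fin C)
    (Subtype.val : {i // d.2.1 i ∈ B.map Function.Embedding.some} → Fin C)).rank

/-- The stored labels suffice to select the rows and columns of a query; nonterminals get the label
`none`. -/
theorem partialInv_mem_map_some {V : Type*} {q : Fin k ↪ V} {v : V} {A : Finset (Fin k)} :
    Function.partialInv q v ∈ A.map Function.Embedding.some ↔ v ∈ A.map q := by
  simp only [mem_map, Function.Embedding.some_apply]
  refine exists_congr fun i => and_congr_right fun _ => ?_
  rw [eq_comm, q.injective.isPartialInv]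

variable {V : Type*} [Fintype V] [DecidableEq V]

theorem exists_value_isMinCutValue [Field F] [Finite F] (G : CapDigraph V) (q : Fin k ↪ V)
    (hF : (4 ^ k + 1) * Fintype.card G.Edge < Nat.card F) :
    ∃ d : CutMatrix F k (G.incidentCapacity (univ.map q)), ∀ A B : Finset (Fin k), Disjoint A B →
      G.IsMinCutValue (A.map q) (B.map q) (d.value A B) := by
  classical
  let J := {p : Finset (Fin k) × Finset (Fin k) // Disjoint p.1 p.2}
  have hJ : Fintype.card J ≤ 4 ^ k := by
    refine (Fintype.card_subtype_le _).trans ?_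
    simp [← mul_pow]
  choose m hm using fun j : J => G.exists_isMinCutValue ((disjoint_map q).2 j.2)
  obtain ⟨N, hN⟩ := EdgeCut.exists_matrix_rank_eq_minCut (F := F)
    (tail := fun e : G.Edge => e.1.1) (head := fun e => e.1.2) (J := J)
    (A := fun j => j.1.1.map q) (B := fun j => j.1.2.map q) (m := m)
    (fun j => (disjoint_map q).2 j.2)
    (fun j => by simp only [G.cutCard_edge]; exact hm j)
    ((Nat.mul_le_mul_right _ (by omega)).trans_lt hF)
  let T := univ.map q
  let φ : Fin (G.incidentCapacity T) ≃ {e : G.Edge // e.1.1 ∈ T ∨ e.1.2 ∈ T} :=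
    (finCongr (by
      rw [Fintype.card_subtype]
      exact (G.card_filter_edge fun p => p.1 ∈ T ∨ p.2 ∈ T).symm)).trans (Fintype.equivFin _).symm
  let d : CutMatrix F k (G.incidentCapacity T) :=
    ⟨fun i => Function.partialInv q (φ i).1.1.1, fun i => Function.partialInv q (φ i).1.1.2,
      N.submatrix (fun i => φ i) (fun i => φ i)⟩
  refine ⟨d, fun A B hAB => ?_⟩
  let α : {i // d.1 i ∈ A.map Function.Embedding.some} ≃ {e : G.Edge // e.1.1 ∈ A.map q} :=
    Equiv.ofBijective (fun i => ⟨φ i, partialInv_mem_map_some.1 i.2⟩)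
      ⟨fun i j h => Subtype.ext (φ.injective (Subtype.ext (congrArg (fun e => e.1) h))),
        fun e => by
          have he : e.1.1.1 ∈ T := map_subset_map.2 (subset_univ A) e.2
          refine ⟨⟨φ.symm ⟨e.1, Or.inl he⟩, partialInv_mem_map_some.2 ?_⟩, Subtype.ext ?_⟩
          · simpa using e.2
          · simp⟩
  let β : {i // d.2.1 i ∈ B.map Function.Embedding.some} ≃ {e : G.Edge // e.1.2 ∈ B.map q} :=
    Equiv.ofBijective (fun i => ⟨φ i, partialInv_mem_map_some.1 i.2⟩)
      ⟨fun i j h => Subtype.ext (φ.injective (Subtype.ext (congrArg (fun e => e.1) h))),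
        fun e => by
          have he : e.1.1.2 ∈ T := map_subset_map.2 (subset_univ B) e.2
          refine ⟨⟨φ.symm ⟨e.1, Or.inr he⟩, partialInv_mem_map_some.2 ?_⟩, Subtype.ext ?_⟩
          · simpa using e.2
          · simp⟩
  have hd : d.value A B = m ⟨(A, B), hAB⟩ := by
    rw [← hN ⟨(A, B), hAB⟩, ← Matrix.rank_submatrix _ α β]
    rfl
  rw [hd]
  exact hm ⟨(A, B), hAB⟩

/-- A pure count: each of the `2 * C` labels fits in 2 words and each of the `C ^ 2` entries in `7 *
k` words. As `C ≤ k * C ^ 2`, the total is at most `(4 + 7) * k * C ^ 2`. -/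
theorem exists_injective_words {w : ℕ} [Finite F] (hF : Nat.card F = 2 ^ (7 * k * w)) (hk : 1 ≤ k)
    (hkw : k + 1 ≤ 2 ^ (2 * w)) :
    ∃ f : CutMatrix F k C → Fin (11 * (k * C ^ 2)) → BitVec w, f.Injective := by
  classical
  have := Fintype.ofFinite F
  rw [Nat.card_eq_fintype_card] at hF
  have hcard : Fintype.card (CutMatrix F k C) ≤
      Fintype.card (Fin (11 * (k * C ^ 2)) → Fin (2 ^ w)) := by
    have h₁ : Fintype.card (CutMatrix F k C) =
        (k + 1) ^ C * ((k + 1) ^ C * ((2 ^ (7 * k * w)) ^ C) ^ C) := by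
      rw [Fintype.card_prod, Fintype.card_prod]
      have h₂ : Fintype.card (Matrix (Fin C) (Fin C) F) = (Fintype.card F ^ C) ^ C :=
        Fintype.card_fun.trans (by simp)
      rw [h₂, hF]
      simp
    rw [h₁, Fintype.card_fun, Fintype.card_fin, Fintype.card_fin]
    calc (k + 1) ^ C * ((k + 1) ^ C * ((2 ^ (7 * k * w)) ^ C) ^ C)
        ≤ (2 ^ (2 * w)) ^ C * ((2 ^ (2 * w)) ^ C * ((2 ^ (7 * k * w)) ^ C) ^ C) := by gcongr
      _ = 2 ^ (4 * w * C + 7 * k * w * C ^ 2) := by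
        simp only [← pow_mul, ← pow_add]
        congr 1
        ring
      _ ≤ 2 ^ (w * (11 * (k * C ^ 2))) := by
        refine Nat.pow_le_pow_right two_pos ?_
        have h₂ : w * C ≤ w * (k * C ^ 2) :=
          Nat.mul_le_mul_left _ ((Nat.le_self_pow two_ne_zero C).trans
            (Nat.le_mul_of_pos_left _ hk))
        calc 4 * w * C + 7 * k * w * C ^ 2 = 4 * (w * C) + 7 * (w * (k * C ^ 2)) := by ring
          _ ≤ 4 * (w * (k * C ^ 2)) + 7 * (w * (k * C ^ 2)) := by gcongr
          _ = _ := by ring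
      _ = _ := pow_mul _ _ _
  obtain ⟨f⟩ := Function.Embedding.nonempty_of_card_le hcard
  exact ⟨fun d i => BitVec.equivFin.symm (f d i), fun d d' h => f.injective
    (funext fun i => BitVec.equivFin.symm.injective (congrFun h i))⟩

end CutMatrix

/-! ### Assembling the sketch. -/

namespace CutSketch

variable {V : Type*} [Fintype V] [DecidableEq V] {k w : ℕ}

/-- The empty sketch is exact when no capacity is incident on the terminals. -/
theorem exists_of_incidentCapacity_eq_zero (c : ℕ) {valid : CapDigraph V → Prop}
    (h : ∀ (G : CapDigraph V) (q : Fin k ↪ V), valid G → G.incidentCapacity (univ.map q) = 0) :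
    ∃ Γ : CutSketch w V k, ∀ (G : CapDigraph V) (q : Fin k ↪ V), valid G →
      Γ.IsExactOn G q ∧ Γ.size G q ≤ c * (k * G.incidentCapacity (univ.map q) ^ 2) :=
  ⟨⟨fun _ _ => [], fun _ _ _ => 0⟩, fun G q hG => ⟨fun _ _ hAB => G.isMinCutValue_zero
    (map_subset_map.2 (subset_univ _)) ((disjoint_map q).2 hAB) (h G q hG), Nat.zero_le _⟩⟩

/-- A sketch from linear representations over a field with `2 ^ (7 * k * w)` elements. -/
theorem exists_of_pos (hk : 1 ≤ k) (hw : 1 ≤ w) (hkV : k ≤ Fintype.card V)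
    (hV : Fintype.card V ≤ 2 ^ w) :
    ∃ Γ : CutSketch w V k, ∀ (G : CapDigraph V) (q : Fin k ↪ V), (∀ u v, G.cap u v < 2 ^ w) →
      Γ.IsExactOn G q ∧ Γ.size G q ≤ 11 * (k * G.incidentCapacity (univ.map q) ^ 2) := by
  classical
  have : Fact (Nat.Prime 2) := ⟨Nat.prime_two⟩
  have hkw : k ≤ k * w := Nat.le_mul_of_pos_right _ hw
  have hwk : w ≤ k * w := Nat.le_mul_of_pos_left _ hk
  -- The field depends on `k` and `w` only, so extraction knows it. The exponent `7 * k * w` exceeds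
  -- `2 * k + 1 + 3 * w`, which bounds the logarithm of the degree in Schwartz–Zippel.
  let F := GaloisField 2 (7 * k * w)
  have hF : Nat.card F = 2 ^ (7 * k * w) := GaloisField.card 2 _ (by positivity)
  have hrep : ∀ (G : CapDigraph V) (q : Fin k ↪ V), (∀ u v, G.cap u v < 2 ^ w) →
      ∃ d : CutMatrix F k (G.incidentCapacity (univ.map q)), ∀ A B : Finset (Fin k),
        Disjoint A B → G.IsMinCutValue (A.map q) (B.map q) (d.value A B) := by
    refine fun G q hG => CutMatrix.exists_value_isMinCutValue G q ?_
    rw [hF]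
    calc (4 ^ k + 1) * Fintype.card G.Edge
        ≤ (2 ^ (2 * k) + 2 ^ (2 * k)) * ((2 ^ w) ^ 2 * 2 ^ w) := by
          refine Nat.mul_le_mul ?_ ((G.card_edge_le fun u v => (hG u v).le).trans (by gcongr))
          rw [show 4 ^ k = 2 ^ (2 * k) from (pow_mul 2 2 k).symm]
          exact Nat.add_le_add_left Nat.one_le_two_pow _
      _ = 2 ^ (2 * k + 1 + 3 * w) := by ring
      _ < 2 ^ (7 * k * w) := by
          refine Nat.pow_lt_pow_right one_lt_two ?_
          rw [mul_assoc]
          omega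
  choose! d hd using hrep
  have hkw' : k + 1 ≤ 2 ^ (2 * w) := by
    calc k + 1 ≤ 2 ^ w + 2 ^ w := Nat.add_le_add (hkV.trans hV) Nat.one_le_two_pow
      _ = 2 ^ (w + 1) := by ring
      _ ≤ 2 ^ (2 * w) := Nat.pow_le_pow_right two_pos (by omega)
  choose f hf using fun C => CutMatrix.exists_injective_words (C := C) hF hk hkw'
  let encode : (Σ C, CutMatrix F k C) → List (BitVec w) := fun d => List.ofFn (f d.1 d.2)
  have hencode : encode.Injective := by
    rintro ⟨C, d⟩ ⟨C', d'⟩ h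
    -- As `k` is positive, the length of the sketch determines `C`, which need not be stored
    -- separately.
    have hlen : 11 * (k * C ^ 2) = 11 * (k * C' ^ 2) := by
      simpa only [encode, List.length_ofFn] using congrArg List.length h
    obtain rfl : C = C' := Nat.pow_left_injective (by norm_num : 2 ≠ 0)
      (Nat.eq_of_mul_eq_mul_left hk (Nat.eq_of_mul_eq_mul_left (by norm_num) hlen))
    exact congrArg _ (hf C (List.ofFn_injective h))
  have : Nonempty (Σ C, CutMatrix F k C) := ⟨⟨0, Fin.elim0, Fin.elim0, 0⟩⟩
  refine ⟨⟨fun G q => encode ⟨_, d G q⟩, fun l => (Function.invFun encode l).2.value⟩,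
    fun G q hG => ⟨fun A B hAB => ?_, ?_⟩⟩
  · dsimp only
    rw [Function.leftInverse_invFun hencode]
    exact hd G q hG A B hAB
  · simp [size, encode]

end CutSketch

theorem theorem3 :
    ∃ c : ℕ, ∀ b : ℕ, 1 ≤ b →
      ∀ (V : Type*) [Fintype V] [DecidableEq V] (k : ℕ),
        ∃ Γ : CutSketch (wordLength b (Fintype.card V)) V k,
          ∀ (G : CapDigraph V) (q : Fin k ↪ V),
            (∀ u v : V, G.cap u v < 2 ^ wordLength b (Fintype.card V)) →
              Γ.IsExactOn G q ∧
                Γ.size G q ≤ c * (k * G.incidentCapacity (Finset.univ.map q) ^ 2) := by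
  refine ⟨11, fun b hb V _ _ k => ?_⟩
  rcases Nat.eq_zero_or_pos k with rfl | hk
  · exact CutSketch.exists_of_incidentCapacity_eq_zero 11
      fun G q _ => by simp [CapDigraph.incidentCapacity]
  -- With words of zero bits, every capacity is less than `2 ^ 0`, hence zero.
  rcases Nat.eq_zero_or_pos (wordLength b (Fintype.card V)) with hw | hw
  · exact CutSketch.exists_of_incidentCapacity_eq_zero 11
      fun G q hG => Finset.sum_eq_zero fun p _ => by simpa [hw] using hG p.1 p.2
  by_cases hkV : k ≤ Fintype.card V
  · exact CutSketch.exists_of_pos hk hw hkV ((Nat.le_pow_clog one_lt_two _).trans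
      (Nat.pow_le_pow_right two_pos (Nat.le_mul_of_pos_left _ hb)))
  -- More terminals than vertices: no embedding `q` exists.
  · exact CutSketch.exists_of_incidentCapacity_eq_zero 11
      fun G q _ => absurd (by simpa using Fintype.card_le_of_embedding q) hkV
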